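/- Let $X=(x_1,\dots,x_k)$ be a finite list of vectors in $\mathbb{Z}^n$ (repetitions allowed) that spans $\mathbb{R}^n$ as a real vector space, and let $$\mathcal{Z}(X)=\Big\{\sum_{i=1}^k t_i x_i : 0\le t_i\le 1\Big\}\subset\mathbb{R}^n$$ be its zonotope. For a sublist $A\subseteq X$ (given by a set of positions), let $|A|$ be its length, $\langle A\rangle_{\mathbb{R}}$ and $\langle A\rangle_{\mathbb{Z}}$ the real subspace and the subgroup of $\mathbb{Z}^n$ that it generates, $r(A)=\dim\langle A\rangle_{\mathbb{R}}$, and $m(A)=[\mathbb{Z}^n\cap\langle A\rangle_{\mathbb{R}}:\langle A\rangle_{\mathbb{Z}}]$. The multiplicity Tutte polynomial of $X$ is $$M_X(x,y)=\sum_{A\subseteq X} m(A)\,(x-1)^{n-r(A)}(y-1)^{|A|-r(A)}.$$ Theorem. There is exactly one polynomial $\mathcal{E}_X\in\mathbb{R}[q]$ (the Ehrhart polynomial of $\mathcal{Z}(X)$) such that $\mathcal{E}_X(q)=|q\mathcal{Z}(X)\cap\mathbb{Z}^n|$ for every integer $q\ge 0$, and it satisfies $$\mathcal{E}_X(q)=q^n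 M_X(1+1/q,\,1)\quad\text{for every real } q\neq 0.$$ Equivalently, $$\mathcal{E}_X(q)=\sum_{A} m(A)\,q^{|A|}$$ as polynomials in $q$, where the sum is over the linearly independent sublists $A$ of $X$. -/

import Mathlib

open scoped Pointwise Polynomial

namespace IntZonotope

/-- The inclusion of the lattice `ℤⁿ` in `ℝⁿ`. -/
def emb (n : ℕ) : (Fin n → ℤ) →+ (Fin n → ℝ) :=
  (Int.castAddHom ℝ).compLeft (Fin n)

/-- The lattice `ℤⁿ` as a subset of `ℝⁿ`. -/
def lattice (n : ℕ) : Set (Fin n → ℝ) := Set.range (emb n)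

/-- The number of lattice points in the dilation `q P`. -/
noncomputable def ehrhartCount {n : ℕ} (P : Set (Fin n → ℝ)) (q : ℕ) : ℕ :=
  ((q : ℝ) • P ∩ lattice n).ncard

/-- `E` is the Ehrhart polynomial of `P`: for every natural number `q`, its value at `q` is the
number of lattice points of `q P`. -/
def IsEhrhartPolynomial {n : ℕ} (P : Set (Fin n → ℝ)) (E : ℝ[X]) : Prop :=
  ∀ q : ℕ, E.eval (q : ℝ) = (ehrhartCount P q : ℝ)

section

variable {n k : ℕ} (X : Fin k → Fin n → ℤ)

/-- The zonotope of the list `X = (X 0, …, X (k-1))`. -/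
def zonotope : Set (Fin n → ℝ) :=
  {v | ∃ t : Fin k → ℝ, (∀ i, 0 ≤ t i ∧ t i ≤ 1) ∧ v = ∑ i, t i • emb n (X i)}

/-- The real subspace spanned by the sublist `A` of `X`. A sublist is given by its set of
positions, so that repeated entries of `X` are kept apart. -/
def realSpan (A : Finset (Fin k)) : Submodule ℝ (Fin n → ℝ) :=
  Submodule.span ℝ ((fun i => emb n (X i)) '' (A : Set (Fin k)))

/-- The rank of the sublist `A`. -/
noncomputable def rk (A : Finset (Fin k)) : ℕ := Module.finrank ℝ (realSpan X A)

/-- The sublattice of `ℤⁿ` generated by the sublist `A`. -/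
def intSpan (A : Finset (Fin k)) : AddSubgroup (Fin n → ℤ) :=
  AddSubgroup.closure (X '' (A : Set (Fin k)))

/-- The lattice points in the real span of the sublist `A`. -/
def satSpan (A : Finset (Fin k)) : AddSubgroup (Fin n → ℤ) :=
  (realSpan X A).toAddSubgroup.comap (emb n)

/-- The multiplicity of `A`: the index of the lattice generated by `A` in the group of lattice
points of its real span. -/
noncomputable def mult (A : Finset (Fin k)) : ℕ := (intSpan X A).relIndex (satSpan X A)

/-- The multiplicity Tutte polynomial of `X`; variable `0` is `x` and variable `1` is `y`. The
subtractions in the exponents never truncate, as `rk X A ≤ n` and `rk X A ≤ |A|`. -/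
noncomputable def multTutte : MvPolynomial (Fin 2) ℤ :=
  ∑ A : Finset (Fin k), MvPolynomial.C (mult X A : ℤ) *
    (MvPolynomial.X 0 - 1) ^ (n - rk X A) * (MvPolynomial.X 1 - 1) ^ (A.card - rk X A)

open Classical in
/-- The linearly independent sublists of `X`. -/
noncomputable def indepSublists : Finset (Finset (Fin k)) :=
  Finset.univ.filter fun A =>
    LinearIndependent ℝ (fun i : {i : Fin k // i ∈ A} => emb n (X i.1))

end

end IntZonotope

/-! Deletion and contraction of one vector `x`. Sweeping a convex set `Z` along `x` adds exactly one
lattice point in each coset of `ℤx` whose real line meets `Z` (`ncard_preimage_sweep_one`), so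
sweeping along `q x` adds `q` times the count for the projection of `Z` modulo `x`. Contraction
preserves multiplicities (`relMult_insert`), so induction on the list gives the sum over independent
sublists (`ncard_preimage_box`). Since `ℤⁿ / ℤx` may have torsion, the induction runs over all
homomorphisms `φ : Λ →+ V` with finite counts, and points are counted in `Λ`, hence with the size of
the fibre of `φ`. In the Tutte polynomial, `y = 1` kills the dependent sublists. -/

namespace IntZonotope

/-! ### Dilated zonotopes of subfamilies -/

section Box

variable {ι V W : Type*} [AddCommGroup V] [Module ℝ V] [AddCommGroup W] [Module ℝ W]

/-- The sums `∑ i ∈ s, t i • v i` with all coefficients between `0` and `q`. -/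
def box (q : ℝ) (s : Finset ι) (v : ι → V) : Set V :=
  {y | ∃ t : ι → ℝ, (∀ i, 0 ≤ t i ∧ t i ≤ q) ∧ y = ∑ i ∈ s, t i • v i}

theorem convex_box (q : ℝ) (s : Finset ι) (v : ι → V) : Convex ℝ (box q s v) := by
  rintro _ ⟨t, ht, rfl⟩ _ ⟨u, hu, rfl⟩ a b ha hb hab
  refine ⟨fun i => a * t i + b * u i, fun i => ⟨?_, ?_⟩, ?_⟩
  · have := (ht i).1
    have := (hu i).1
    positivity
  · calc a * t i + b * u i ≤ a * q + b * q := by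
          gcongr
          exacts [(ht i).2, (hu i).2]
      _ = q := by rw [← add_mul, hab, one_mul]
  · simp only [Finset.smul_sum, ← Finset.sum_add_distrib, smul_smul, add_smul]

theorem box_mono {q r : ℝ} (h : q ≤ r) (s : Finset ι) (v : ι → V) : box q s v ⊆ box r s v := by
  rintro _ ⟨t, ht, rfl⟩
  exact ⟨t, fun i => ⟨(ht i).1, (ht i).2.trans h⟩, rfl⟩

theorem box_empty {q : ℝ} (hq : 0 ≤ q) (v : ι → V) : box q ∅ v = {0} := by
  ext y
  constructor
  · rintro ⟨t, -, rfl⟩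
    simp
  · rintro rfl
    exact ⟨0, fun i => ⟨le_rfl, hq⟩, by simp⟩

theorem mem_box_insert [DecidableEq ι] {q : ℝ} {a : ι} {s : Finset ι} (ha : a ∉ s) {v : ι → V}
    {y : V} :
    y ∈ box q (insert a s) v ↔ ∃ c : ℝ, 0 ≤ c ∧ c ≤ q ∧ y - c • v a ∈ box q s v := by
  constructor
  · rintro ⟨t, ht, rfl⟩
    exact ⟨t a, (ht a).1, (ht a).2, t, ht, by rw [Finset.sum_insert ha, add_sub_cancel_left]⟩
  · rintro ⟨c, hc, hcq, t, ht, hy⟩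
    refine ⟨Function.update t a c, fun i => ?_, ?_⟩
    · by_cases h : i = a
      · subst h; simp [hc, hcq]
      · simpa [h] using ht i
    · rw [Finset.sum_insert ha, Function.update_self, eq_add_of_sub_eq' hy]
      congr 1
      refine Finset.sum_congr rfl fun i hi => ?_
      rw [Function.update_of_ne]
      rintro rfl
      exact ha hi

theorem image_box (f : V →ₗ[ℝ] W) (q : ℝ) (s : Finset ι) (v : ι → V) :
    f '' box q s v = box q s (fun i => f (v i)) := by
  ext y
  constructor
  · rintro ⟨_, ⟨t, ht, rfl⟩, rfl⟩
    exact ⟨t, ht, by simp⟩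
  · rintro ⟨t, ht, rfl⟩
    exact ⟨_, ⟨t, ht, rfl⟩, by simp⟩

end Box

/-! ### Sweeping a convex set and projecting along a vector -/

section Contraction

variable {Λ V : Type*} [AddCommGroup Λ] [AddCommGroup V] [Module ℝ V]

/-- The homomorphism induced by `φ` from the quotient by the multiples of `x` to the quotient
by the line of `φ x`. -/
def contract (φ : Λ →+ V) (x : Λ) :
    Λ ⧸ AddSubgroup.zmultiples x →+ V ⧸ Submodule.span ℝ {φ x} :=
  QuotientAddGroup.lift _ ((Submodule.span ℝ {φ x}).mkQ.toAddMonoidHom.comp φ) (by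
    rw [AddSubgroup.zmultiples_le]
    simp [AddMonoidHom.mem_ker])

@[simp]
theorem contract_mk (φ : Λ →+ V) (x p : Λ) :
    contract φ x (p : Λ ⧸ AddSubgroup.zmultiples x) = (Submodule.span ℝ {φ x}).mkQ (φ p) := rfl

theorem mkQ_mem_image_mkQ {u w : V} {Z : Set V} :
    (Submodule.span ℝ {u}).mkQ w ∈ (Submodule.span ℝ {u}).mkQ '' Z ↔
      ∃ c : ℝ, w - c • u ∈ Z := by
  constructor
  · rintro ⟨z, hz, h⟩
    rw [Submodule.mkQ_apply, Submodule.mkQ_apply, eq_comm, Submodule.Quotient.eq,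
      Submodule.mem_span_singleton] at h
    obtain ⟨c, hc⟩ := h
    exact ⟨c, by rwa [hc, sub_sub_cancel]⟩
  · rintro ⟨c, hc⟩
    refine ⟨_, hc, ?_⟩
    rw [Submodule.mkQ_apply, Submodule.mkQ_apply, Submodule.Quotient.eq,
      Submodule.mem_span_singleton]
    exact ⟨-c, by simp⟩

theorem mk_mem_preimage_contract (φ : Λ →+ V) (x p : Λ) (Z : Set V) :
    (p : Λ ⧸ AddSubgroup.zmultiples x) ∈
        contract φ x ⁻¹' ((Submodule.span ℝ {φ x}).mkQ '' Z) ↔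
      ∃ c : ℝ, φ p - c • φ x ∈ Z := by
  rw [Set.mem_preimage, contract_mk, mkQ_mem_image_mkQ]

/-- The Minkowski sum of `Z` with the segment from `0` to `r • u`. -/
def sweep (r : ℝ) (u : V) (Z : Set V) : Set V :=
  {y | ∃ c : ℝ, 0 ≤ c ∧ c ≤ r ∧ y - c • u ∈ Z}

theorem convex_sweep {Z : Set V} (hZ : Convex ℝ Z) (r : ℝ) (u : V) : Convex ℝ (sweep r u Z) := by
  rintro y ⟨c, hc, hcr, hy⟩ z ⟨d, hd, hdr, hz⟩ a b ha hb hab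
  refine ⟨a * c + b * d, by positivity, ?_, ?_⟩
  · calc a * c + b * d ≤ a * r + b * r := by gcongr
      _ = r := by rw [← add_mul, hab, one_mul]
  · convert hZ hy hz ha hb hab using 1
    module

theorem sweep_zero (u : V) (Z : Set V) : sweep 0 u Z = Z := by
  ext y
  constructor
  · rintro ⟨c, hc, hc', h⟩
    simpa [le_antisymm hc' hc] using h
  · intro h
    exact ⟨0, le_rfl, le_rfl, by simpa using h⟩

theorem sweep_sweep_one {r : ℝ} (hr : 0 ≤ r) (u : V) (Z : Set V) :
    sweep 1 u (sweep r u Z) = sweep (r + 1) u Z := by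
  ext y
  constructor
  · rintro ⟨c, hc, hc', d, hd, hd', h⟩
    exact ⟨c + d, by positivity, by linarith, by rwa [add_smul, ← sub_sub]⟩
  · rintro ⟨c, hc, hc', h⟩
    rcases le_total c 1 with h1 | h1
    · exact ⟨c, hc, h1, 0, le_rfl, hr, by simpa using h⟩
    · exact ⟨1, zero_le_one, le_rfl, c - 1, by linarith, by linarith, by
        rwa [sub_sub, ← add_smul, add_sub_cancel]⟩

theorem image_mkQ_sweep {r : ℝ} (hr : 0 ≤ r) (u : V) (Z : Set V) :
    (Submodule.span ℝ {u}).mkQ '' sweep r u Z = (Submodule.span ℝ {u}).mkQ '' Z := by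
  ext y
  obtain ⟨w, rfl⟩ := Submodule.mkQ_surjective _ y
  rw [mkQ_mem_image_mkQ, mkQ_mem_image_mkQ]
  constructor
  · rintro ⟨c, d, -, -, h⟩
    exact ⟨c + d, by rwa [add_smul, ← sub_sub]⟩
  · rintro ⟨c, h⟩
    exact ⟨c, 0, le_rfl, hr, by simpa using h⟩

theorem subset_sweep {r : ℝ} (hr : 0 ≤ r) (u : V) (Z : Set V) : Z ⊆ sweep r u Z :=
  fun y hy => ⟨0, le_rfl, hr, by simpa using hy⟩

theorem map_zsmul_eq_cast_smul (φ : Λ →+ V) (m : ℤ) (x : Λ) : φ (m • x) = (m : ℝ) • φ x := by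
  rw [map_zsmul, Int.cast_smul_eq_zsmul]

/-- Otherwise `φ p` would lie between a point of `Z` behind it and one not behind it, `φ p + (m - d)
• φ x` with `d ≤ 1 ≤ m`, hence in `Z`. -/
theorem notMem_sweep_one_of_notMem (φ : Λ →+ V) {Z : Set V} (hZ : Convex ℝ Z) {x p : Λ} {m : ℤ}
    (hp' : φ p ∈ sweep 1 (φ x) Z) (hp : φ p ∉ Z) (hm : 0 < m) :
    φ (p + m • x) ∉ sweep 1 (φ x) Z := by
  obtain ⟨c, hc0, hc1, hc⟩ := hp'
  rintro ⟨d, hd0, hd1, hd⟩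
  have hm' : (1 : ℝ) ≤ m := by exact_mod_cast hm
  refine hp ?_
  rw [map_add, map_zsmul_eq_cast_smul] at hd
  rcases hc0.eq_or_lt with rfl | hc0
  · simpa using hc
  have hpos : 0 < m - d + c := by linarith
  have hb : c / (m - d + c) * (m - d + c) = c := div_mul_cancel₀ _ hpos.ne'
  have hb0 : 0 ≤ c / (m - d + c) := by positivity
  have hb1 : c / (m - d + c) ≤ 1 := (div_le_one hpos).2 (by linarith)
  generalize c / (m - d + c) = b at *
  have h := hZ hc hd (sub_nonneg.2 hb1) hb0 (sub_add_cancel 1 b)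
  have e : (1 - b) • (φ p - c • φ x) + b • (φ p + (m : ℝ) • φ x - d • φ x)
      = φ p + (b * (m - d + c) - c) • φ x := by module
  rwa [e, hb, sub_self, zero_smul, add_zero] at h

/-- Sweeping a convex set along the image of `x` adds one lattice point on each line parallel
to it that carries lattice points and meets the set. -/
theorem ncard_preimage_sweep_one (φ : Λ →+ V) {x : Λ} (hx : φ x ≠ 0) {Z : Set V}
    (hZ : Convex ℝ Z) (hfin : (φ ⁻¹' sweep 1 (φ x) Z).Finite) :
    (φ ⁻¹' sweep 1 (φ x) Z).ncard = (φ ⁻¹' Z).ncard +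
      (contract φ x ⁻¹' ((Submodule.span ℝ {φ x}).mkQ '' Z)).ncard := by
  have hsub : φ ⁻¹' Z ⊆ φ ⁻¹' sweep 1 (φ x) Z :=
    Set.preimage_mono (subset_sweep zero_le_one _ _)
  have hbij : Set.BijOn (QuotientAddGroup.mk : Λ → Λ ⧸ AddSubgroup.zmultiples x)
      (φ ⁻¹' sweep 1 (φ x) Z \ φ ⁻¹' Z)
      (contract φ x ⁻¹' ((Submodule.span ℝ {φ x}).mkQ '' Z)) := by
    refine ⟨?_, ?_, ?_⟩
    · rintro p ⟨⟨c, -, -, hc⟩, -⟩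
      exact (mk_mem_preimage_contract ..).2 ⟨c, hc⟩
    · have key := fun p m => notMem_sweep_one_of_notMem φ hZ (x := x) (p := p) (m := m)
      intro p hp r hr hpr
      rw [QuotientAddGroup.eq, AddSubgroup.mem_zmultiples_iff] at hpr
      obtain ⟨m, hm⟩ := hpr
      have hr' : r = p + m • x := by rw [hm]; abel
      rcases lt_trichotomy m 0 with h | rfl | h
      · refine absurd hp.1 ?_
        have hp' : p = r + (-m) • x := by rw [hr']; simp
        rw [hp']
        exact key r _ hr.1 hr.2 (by omega)
      · simpa using hr'.symm
      · refine absurd hr.1 ?_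
        rw [hr']
        exact key p _ hp.1 hp.2 h
    · intro p' hp'
      obtain ⟨p, rfl⟩ := QuotientAddGroup.mk_surjective p'
      obtain ⟨c, hc⟩ := (mk_mem_preimage_contract ..).1 hp'
      set S : Set ℤ := {m | p + m • x ∈ φ ⁻¹' sweep 1 (φ x) Z} with hS
      have hSfin : S.Finite := by
        refine hfin.preimage (f := fun m : ℤ => p + m • x) fun m _ m' _ h => ?_
        have h' : φ (m • x) = φ (m' • x) := congrArg φ (add_left_cancel h)
        rw [map_zsmul_eq_cast_smul, map_zsmul_eq_cast_smul] at h'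
        exact Int.cast_injective (smul_left_injective ℝ hx h')
      have hSne : S.Nonempty := by
        refine ⟨⌈-c⌉, c + ⌈-c⌉, by linarith [Int.le_ceil (-c)],
          by linarith [Int.ceil_lt_add_one (-c)], ?_⟩
        rw [map_add, map_zsmul_eq_cast_smul]
        convert hc using 1
        module
      -- The last swept point of the coset is new: were it in `Z`, its translate by `x` would be
      -- swept too.
      obtain ⟨m, hm, hmax⟩ := hSfin.exists_maximal hSne
      refine ⟨p + m • x, ⟨hm, fun h => ?_⟩, ?_⟩
      · have : m + 1 ∈ S := by
          refine ⟨1, zero_le_one, le_rfl, ?_⟩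
          rw [map_add, map_zsmul_eq_cast_smul]
          rw [Set.mem_preimage, map_add, map_zsmul_eq_cast_smul] at h
          convert h using 1
          push_cast
          module
        have := hmax this (by simp)
        omega
      · rw [eq_comm, QuotientAddGroup.eq, AddSubgroup.mem_zmultiples_iff]
        exact ⟨m, by abel⟩
  rw [← hbij.image_eq, hbij.injOn.ncard_image, add_comm,
    Set.ncard_sdiff_add_ncard_of_subset hsub hfin]

/-- Each unit sweep adds the same number, as sweeping does not change the projection. -/
theorem ncard_preimage_sweep (φ : Λ →+ V) {x : Λ} (hx : φ x ≠ 0) {Z : Set V}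
    (hZ : Convex ℝ Z) (hfin : ∀ q : ℕ, (φ ⁻¹' sweep q (φ x) Z).Finite) (q : ℕ) :
    (φ ⁻¹' sweep q (φ x) Z).ncard = (φ ⁻¹' Z).ncard +
      q * (contract φ x ⁻¹' ((Submodule.span ℝ {φ x}).mkQ '' Z)).ncard := by
  induction q with
  | zero => simp [sweep_zero]
  | succ q ih =>
    have h := hfin (q + 1)
    push_cast at h ⊢
    rw [← sweep_sweep_one q.cast_nonneg] at h ⊢
    rw [ncard_preimage_sweep_one φ hx (convex_sweep hZ _ _) h, ih,
      image_mkQ_sweep q.cast_nonneg]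
    ring

end Contraction

/-! ### Counting by deletion and contraction -/

section Count

variable {ι : Type*} {Λ V : Type*} [AddCommGroup Λ] [AddCommGroup V] [Module ℝ V]

/-- The multiplicity of the subfamily `A` of `X` with respect to `φ`: the index of the subgroup
that it generates in the preimage of the real span of its image. -/
noncomputable def relMult (φ : Λ →+ V) (X : ι → Λ) (A : Finset ι) : ℕ :=
  (AddSubgroup.closure (X '' (A : Set ι))).relIndex
    ((Submodule.span ℝ ((fun i => φ (X i)) '' (A : Set ι))).toAddSubgroup.comap φ)

/-- The two subgroups on the left are the preimages of those on the right under the quotient map,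
and pulling back along a surjection keeps the index. -/
theorem relMult_insert [DecidableEq ι] (φ : Λ →+ V) (X : ι → Λ) (a : ι) (A : Finset ι) :
    relMult φ X (insert a A) =
      relMult (contract φ (X a)) (fun i => (X i : Λ ⧸ AddSubgroup.zmultiples (X a))) A := by
  set π := QuotientAddGroup.mk' (AddSubgroup.zmultiples (X a)) with hπ
  have hπs : Function.Surjective π := QuotientAddGroup.mk'_surjective _
  have h1 : (AddSubgroup.closure ((fun i => (X i : Λ ⧸ AddSubgroup.zmultiples (X a))) ''
      (A : Set ι))).comap π = AddSubgroup.closure (X '' ((insert a A : Finset ι) : Set ι)) := by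
    have : (fun i => (X i : Λ ⧸ AddSubgroup.zmultiples (X a))) '' (A : Set ι) =
        π '' (X '' (A : Set ι)) := by rw [Set.image_image]; rfl
    rw [this, ← AddMonoidHom.map_closure, AddSubgroup.comap_map_eq, QuotientAddGroup.ker_mk',
      Finset.coe_insert, Set.image_insert_eq, Set.insert_eq, AddSubgroup.closure_union, sup_comm,
      AddSubgroup.zmultiples_eq_closure]
  have h2 : ((Submodule.span ℝ ((fun i => contract φ (X a)
      (X i : Λ ⧸ AddSubgroup.zmultiples (X a))) '' (A : Set ι))).toAddSubgroup.comap
        (contract φ (X a))).comap π = (Submodule.span ℝ ((fun i => φ (X i)) ''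
          ((insert a A : Finset ι) : Set ι))).toAddSubgroup.comap φ := by
    have : (fun i => contract φ (X a) (X i : Λ ⧸ AddSubgroup.zmultiples (X a))) '' (A : Set ι) =
        (Submodule.span ℝ {φ (X a)}).mkQ '' ((fun i => φ (X i)) '' (A : Set ι)) := by
      rw [Set.image_image]; rfl
    rw [this, ← Submodule.map_span, Finset.coe_insert, Set.image_insert_eq,
      Submodule.span_insert]
    ext p
    rw [← Submodule.comap_map_mkQ]
    rfl
  rw [relMult, relMult, ← h1, ← h2, AddSubgroup.relIndex_comap,
    AddSubgroup.map_comap_eq_self_of_surjective hπs]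

theorem linearIndepOn_insert_iff_mkQ [DecidableEq ι] {v : ι → V} {a : ι} {A : Finset ι}
    (ha : a ∉ A) (hv : v a ≠ 0) :
    LinearIndepOn ℝ v ((insert a A : Finset ι) : Set ι) ↔
      LinearIndepOn ℝ (fun i => (Submodule.span ℝ {v a}).mkQ (v i)) (A : Set ι) := by
  have h := LinearIndepOn.quotient_iff_union (R := ℝ) (s := {a}) (t := (A : Set ι)) (f := v)
    (by simpa using hv) (by simpa using ha)
  rw [Finset.coe_insert, Set.insert_eq, ← h, Set.image_singleton]
  rfl

theorem finite_preimage_contract [DecidableEq ι] {φ : Λ →+ V} {X : ι → Λ} {a : ι}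
    {s : Finset ι} (ha : a ∉ s)
    (hfin : ∀ q : ℕ, (φ ⁻¹' box q (insert a s) fun i => φ (X i)).Finite) (q : ℕ) :
    (contract φ (X a) ⁻¹' ((Submodule.span ℝ {φ (X a)}).mkQ ''
      box q s fun i => φ (X i))).Finite := by
  refine ((hfin (q + 1)).image (QuotientAddGroup.mk' (AddSubgroup.zmultiples (X a)))).subset ?_
  intro p' hp'
  obtain ⟨p, rfl⟩ := QuotientAddGroup.mk_surjective p'
  obtain ⟨c, hc⟩ := (mk_mem_preimage_contract ..).1 hp'
  -- This representative has the fractional part of `c` as coefficient of `X a`; the bound `q + 1`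
  -- leaves room for it even if `q = 0`.
  refine ⟨p + (-⌊c⌋) • X a, (mem_box_insert ha).2 ⟨c - ⌊c⌋, ?_, ?_, ?_⟩, ?_⟩
  · exact sub_nonneg.2 (Int.floor_le c)
  · have := Int.lt_floor_add_one c
    push_cast
    linarith [(q.cast_nonneg : (0 : ℝ) ≤ q)]
  · rw [map_add, map_zsmul_eq_cast_smul]
    refine box_mono (q := q) (by simp) _ _ ?_
    convert hc using 1
    push_cast
    module
  · rw [QuotientAddGroup.mk'_apply, eq_comm, QuotientAddGroup.eq,
      AddSubgroup.mem_zmultiples_iff]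
    exact ⟨-⌊c⌋, by abel⟩

open Classical in
theorem ncard_preimage_box (s : Finset ι) (φ : Λ →+ V) (X : ι → Λ)
    (hfin : ∀ q : ℕ, (φ ⁻¹' box q s fun i => φ (X i)).Finite) (q : ℕ) :
    (φ ⁻¹' box q s fun i => φ (X i)).ncard =
      ∑ A ∈ s.powerset, if LinearIndepOn ℝ (fun i => φ (X i)) (A : Set ι) then
        relMult φ X A * q ^ A.card else 0 := by
  induction s using Finset.induction_on generalizing Λ V with
  | empty =>
    -- Both sides are the cardinality of the kernel of `φ`.
    simp only [box_empty q.cast_nonneg, Finset.powerset_empty, Finset.sum_singleton,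
      Finset.coe_empty, linearIndepOn_empty, if_true, Finset.card_empty, pow_zero, mul_one,
      relMult, Set.image_empty, AddSubgroup.closure_empty, Submodule.span_empty,
      AddSubgroup.relIndex_bot_left]
    rfl
  | insert a s ha ih =>
    have hsweep : ∀ r : ℕ, box r (insert a s) (fun i => φ (X i)) =
        sweep r (φ (X a)) (box r s fun i => φ (X i)) := fun r =>
      Set.ext fun y => mem_box_insert ha
    have hfin' : ∀ r : ℕ, (φ ⁻¹' box r s fun i => φ (X i)).Finite := fun r =>
      (hfin r).subset <| Set.preimage_mono <| by
        rw [hsweep]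
        exact subset_sweep r.cast_nonneg _ _
    rw [Finset.sum_powerset_insert ha, ← ih φ X hfin']
    by_cases hx : φ (X a) = 0
    · rw [Finset.sum_eq_zero fun A _ => if_neg fun h => h.ne_zero
        (Finset.mem_coe.2 (Finset.mem_insert_self a A)) hx, add_zero]
      congr 2
      ext y
      rw [mem_box_insert ha, hx]
      constructor
      · rintro ⟨c, -, -, h⟩
        simpa using h
      · exact fun h => ⟨0, le_rfl, q.cast_nonneg, by simpa using h⟩
    · have hfins : ∀ r : ℕ, (φ ⁻¹' sweep r (φ (X a)) (box q s fun i => φ (X i))).Finite := by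
        intro r
        refine (hfin (r + q)).subset fun p hp => ?_
        obtain ⟨c, hc, hcr, h⟩ := hp
        exact (mem_box_insert ha).2 ⟨c, hc, hcr.trans (by simp), box_mono (by simp) _ _ h⟩
      have hcon := fun r : ℕ => finite_preimage_contract ha hfin r
      simp only [image_box] at hcon
      rw [hsweep, ncard_preimage_sweep φ hx (convex_box _ _ _) hfins, image_box]
      congr 1
      have := ih (contract φ (X a)) (fun i => (X i : Λ ⧸ AddSubgroup.zmultiples (X a))) hcon
      refine (congrArg (q * ·) this).trans ?_
      rw [Finset.mul_sum]
      refine Finset.sum_congr rfl fun A hA => ?_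
      have haA : a ∉ A := fun h => ha (Finset.mem_powerset.1 hA h)
      rw [relMult_insert, Finset.card_insert_of_notMem haA, mul_ite, mul_zero]
      refine if_congr (linearIndepOn_insert_iff_mkQ (v := fun i => φ (X i)) haA hx).symm ?_ rfl
      ring

end Count

/-! ### The zonotope in `ℝⁿ` and the Tutte polynomial -/

section Lattice

variable {n k : ℕ} (X : Fin k → Fin n → ℤ)

theorem smul_zonotope {q : ℝ} (hq : 0 ≤ q) :
    q • zonotope X = box q Finset.univ fun i => emb n (X i) := by
  ext y
  constructor
  · rintro ⟨_, ⟨t, ht, rfl⟩, rfl⟩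
    refine ⟨fun i => q * t i, fun i => ⟨mul_nonneg hq (ht i).1,
      mul_le_of_le_one_right hq (ht i).2⟩, ?_⟩
    simp only [Finset.smul_sum, smul_smul]
  · rintro ⟨t, ht, rfl⟩
    refine ⟨∑ i, (t i / q) • emb n (X i), ⟨fun i => t i / q, fun i =>
      ⟨div_nonneg (ht i).1 hq, div_le_one_of_le₀ (ht i).2 hq⟩, rfl⟩, ?_⟩
    simp only [Finset.smul_sum, smul_smul]
    refine Finset.sum_congr rfl fun i _ => ?_
    -- For `q = 0` the quotient `t i / q` is `0` by convention, and `t i` vanishes too.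
    rcases hq.eq_or_lt with rfl | hq
    · rw [zero_mul, le_antisymm (ht i).2 (ht i).1]
    · rw [mul_div_cancel₀ _ hq.ne']

theorem emb_injective (n : ℕ) : Function.Injective (emb n) := fun _ _ h =>
  funext fun j => Int.cast_injective (congrFun h j)

theorem finite_preimage_box (q : ℕ) :
    (emb n ⁻¹' box q Finset.univ fun i => emb n (X i)).Finite := by
  refine (Set.finite_Icc (fun j => -∑ i, q * |X i j|) fun j => ∑ i, q * |X i j|).subset ?_
  rintro p ⟨t, ht, hp⟩
  have hb : ∀ j, |p j| ≤ ∑ i, q * |X i j| := fun j => by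
    have hj : (p j : ℝ) = ∑ i, t i * (X i j : ℝ) := by
      have := congrFun hp j
      rw [Finset.sum_apply] at this
      exact this
    have : |(p j : ℝ)| ≤ ∑ i, (q : ℝ) * |(X i j : ℝ)| := by
      rw [hj]
      refine (Finset.abs_sum_le_sum_abs _ _).trans (Finset.sum_le_sum fun i _ => ?_)
      rw [abs_mul, abs_of_nonneg (ht i).1]
      exact mul_le_mul_of_nonneg_right (ht i).2 (abs_nonneg _)
    exact_mod_cast this
  exact ⟨fun j => (abs_le.1 (hb j)).1, fun j => (abs_le.1 (hb j)).2⟩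

theorem ehrhartCount_zonotope (q : ℕ) :
    ehrhartCount (zonotope X) q = ∑ A ∈ indepSublists X, mult X A * q ^ A.card := by
  classical
  rw [ehrhartCount, smul_zonotope X q.cast_nonneg, lattice, ← Set.image_preimage_eq_inter_range,
    Set.ncard_image_of_injective _ (emb_injective n),
    ncard_preimage_box _ _ _ (finite_preimage_box X), Finset.powerset_univ, indepSublists,
    Finset.sum_filter]
  exact Finset.sum_congr rfl fun A _ => if_congr Iff.rfl rfl rfl

theorem eq_of_isEhrhartPolynomial {P : Set (Fin n → ℝ)} {E F : ℝ[X]}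
    (hE : IsEhrhartPolynomial P E) (hF : IsEhrhartPolynomial P F) : E = F := by
  refine Polynomial.eq_of_infinite_eval_eq _ _ <|
    (Set.infinite_range_of_injective (Nat.cast_injective (R := ℝ))).mono ?_
  rintro _ ⟨q, rfl⟩
  exact (hE q).trans (hF q).symm

theorem isEhrhartPolynomial_zonotope :
    IsEhrhartPolynomial (zonotope X) (∑ A ∈ indepSublists X,
      Polynomial.C (mult X A : ℝ) * Polynomial.X ^ A.card) := fun q => by
  simp [ehrhartCount_zonotope, Polynomial.eval_finsetSum]

theorem rk_le (A : Finset (Fin k)) : rk X A ≤ n :=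
  (Submodule.finrank_le _).trans_eq (Module.finrank_fin_fun ℝ)

theorem realSpan_eq_span_range (A : Finset (Fin k)) :
    realSpan X A = Submodule.span ℝ (Set.range fun i : {i : Fin k // i ∈ A} => emb n (X i)) := by
  rw [realSpan, Set.image_eq_range]
  rfl

theorem mem_indepSublists {A : Finset (Fin k)} : A ∈ indepSublists X ↔
    LinearIndependent ℝ fun i : {i : Fin k // i ∈ A} => emb n (X i) := by
  classical
  simp [indepSublists]

theorem rk_eq_card_of_mem {A : Finset (Fin k)} (hA : A ∈ indepSublists X) : rk X A = A.card := by
  rw [rk, realSpan_eq_span_range, finrank_span_eq_card ((mem_indepSublists X).1 hA),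
    Fintype.card_coe]

theorem rk_lt_card_of_notMem {A : Finset (Fin k)} (hA : A ∉ indepSublists X) :
    rk X A < A.card := by
  rw [← not_le]
  intro h
  refine hA ((mem_indepSublists X).2 ?_)
  rwa [linearIndependent_iff_card_le_finrank_span, Fintype.card_coe, Set.finrank,
    ← realSpan_eq_span_range]

theorem aeval_multTutte (q : ℝ) (hq : q ≠ 0) :
    q ^ n * MvPolynomial.aeval ![1 + 1 / q, 1] (multTutte X) =
      ∑ A ∈ indepSublists X, (mult X A : ℝ) * q ^ A.card := by
  rw [multTutte, map_sum, Finset.mul_sum]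
  symm
  refine Finset.sum_subset_zero_on_sdiff (Finset.subset_univ _) (fun A hA => ?_) fun A hA => ?_
  -- The factor `(y - 1) ^ (|A| - r(A))` is a positive power of `0`.
  · have h := Nat.sub_pos_of_lt (rk_lt_card_of_notMem X (Finset.mem_sdiff.1 hA).2)
    simp [h.ne']
  · have h := rk_le X A
    rw [rk_eq_card_of_mem X hA] at h
    obtain ⟨d, hd⟩ := Nat.exists_eq_add_of_le h
    have hn : n - A.card = d := by omega
    have hqn : q ^ n = q ^ A.card * q ^ d := by rw [← pow_add, ← hd]
    simp [rk_eq_card_of_mem X hA, hn, hqn]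
    field_simp

end Lattice

end IntZonotope

theorem theorem3p2 {n k : ℕ} (X : Fin k → Fin n → ℤ)
    (hX : Submodule.span ℝ (Set.range fun i => IntZonotope.emb n (X i)) = ⊤) :
    (∃! E : ℝ[X], IntZonotope.IsEhrhartPolynomial (IntZonotope.zonotope X) E) ∧
    ∀ E : ℝ[X], IntZonotope.IsEhrhartPolynomial (IntZonotope.zonotope X) E →
      (∀ q : ℝ, q ≠ 0 →
        E.eval q = q ^ n * MvPolynomial.aeval ![1 + 1 / q, 1] (IntZonotope.multTutte X)) ∧
      E = ∑ A ∈ IntZonotope.indepSublists X,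
        Polynomial.C (IntZonotope.mult X A : ℝ) * Polynomial.X ^ A.card := by
  have h := IntZonotope.isEhrhartPolynomial_zonotope X
  refine ⟨⟨_, h, fun E hE => IntZonotope.eq_of_isEhrhartPolynomial hE h⟩, fun E hE => ?_⟩
  obtain rfl := IntZonotope.eq_of_isEhrhartPolynomial hE h
  refine ⟨fun q hq => ?_, rfl⟩
  rw [IntZonotope.aeval_multTutte X q hq]
  simp [Polynomial.eval_finsetSum]
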